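/- Consider a link $j$ transmitting on a channel $i$ that is shared by a finite set $\mathcal L_i\ni j$ of links. For $z\in\mathcal L_i$ let $\lambda_{z,j}>0$ be the product of the transmit power of link $z$ and the large-scale fading gain from the transmitter of $z$ to the receiver of $j$, and let $\beta_{i,z,j}$ be the corresponding normalized small-scale fading (power) gain. With noise variance $\sigma^2>0$ the SINR of link $j$ is $$\xi_{i,j}=\frac{\lambda_{j,j}\beta_{i,j,j}}{\sigma^2+\sum_{z\in\mathcal L_i\setminus\{j\}}\lambda_{z,j}\beta_{i,z,j}} .$$ Some of the gains are known (fixed nonnegative numbers), the others are unknown and are independent random variables. Let $\mathcal L'_i\subseteq\mathcal L_i\setminus\{j\}$ be the set of interfering links with unknown gain, and put $\nu=\sigma^2+\sum_{z\in\mathcal L_i\setminus(\{j\}\cup\mathcal L'_i)}\lambda_{z,j}\beta_{i,z,j}$. For $z\in\mathcal L'_i$ the interference link is Nakagami-faded with parameter $m_{z,j}>0$, i.e. $\beta_{i,z,j}=R^2$ in law, where $R$ has the Nakagami distribution with shape $m_{z,j}$ and $\mathbb E[R^2]=1$. The signal gain $\beta_{i,j,j}$ is either known, or unknown with an arbitrary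 probability density $f_j$. Let $\xi_j^{\min}>0$, let $\log$ be the logarithm to a fixed base greater than $1$, and let $$p^s_{i,j}=\Pr[\xi_{i,j}\ge\xi_j^{\min}],\qquad r_{i,j}=\mathbb E\big[\log(1+\xi_{i,j})\,\big|\,\xi_{i,j}\ge\xi_j^{\min}\big]\,p^s_{i,j}\in[0,\infty]$$ be the successful transmission probability and the expected rate (with $r_{i,j}=0$ if $p^s_{i,j}=0$). (a) Suppose $\mathcal L'_i\neq\emptyset$. Put $\theta_j^{\max}=\max_{z\in\mathcal L'_i}\frac{m_{z,j}}{\lambda_{z,j}}$, $\rho=\sum_{z\in\mathcal L'_i}m_{z,j}$, $\eta_{i,j}=\max\big(0,\lambda_{j,j}\beta_{i,j,j}/\xi_j^{\min}-\nu\big)$ (for known $\beta_{i,j,j}$), $\delta_0=1$ and $$\delta_n=\frac1n\sum_{l=1}^n\Big[\sum_{z\in\mathcal L'_i}m_{z,j}\Big(1-\frac{m_{z,j}}{\lambda_{z,j}\,\theta_j^{\max}}\Big)^l\Big]\delta_{n-l}\qquad(n\ge1).$$ Let $\gamma(s,x)=\int_0^x t^{s-1}e^{-t}\,dt$. Then $\delta_n\ge0$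 for all $n$, $$p^s_{i,j}=\prod_{z\in\mathcal L'_i}\Big(\frac{m_{z,j}}{\lambda_{z,j}}\Big)^{m_{z,j}}\sum_{n=0}^\infty\frac{\delta_n(\theta_j^{\max})^{-\rho}\,C_n}{\Gamma(\rho+n)},\qquad r_{i,j}=\log(e)\prod_{z\in\mathcal L'_i}\Big(\frac{m_{z,j}}{\lambda_{z,j}}\Big)^{m_{z,j}}\sum_{n=0}^\infty\frac{\delta_n\,\mu_{\rho+n-1}\,(\theta_j^{\max})^n}{\Gamma(\rho+n)},$$ the first series converging and the second identity holding in $[0,\infty]$, where, if $\beta_{i,j,j}$ is known, $$C_n=\gamma\big(\rho+n,\eta_{i,j}\theta_j^{\max}\big),\qquad \mu_{\rho+n-1}=\int_0^{\eta_{i,j}}\ln\Big(1+\frac{\lambda_{j,j}\beta_{i,j,j}}{\nu+y}\Big)y^{\rho+n-1}e^{-y\theta_j^{\max}}\,dy,$$ and $r_{i,j}<\infty$; and, if $\beta_{i,j,j}$ is unknown, $$C_n=\int_{\xi_j^{\min}\nu/\lambda_{j,j}}^\infty\gamma\Big(\rho+n,\Big(\frac{\lambda_{j,j}x}{\xi_j^{\min}}-\nu\Big)\theta_j^{\max}\Big)f_j(x)\,dx,$$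 $$\mu_{\rho+n-1}=\int_{\xi_j^{\min}\nu/\lambda_{j,j}}^\infty\int_0^{\lambda_{j,j}x/\xi_j^{\min}-\nu}\ln\Big(1+\frac{\lambda_{j,j}x}{\nu+y}\Big)y^{\rho+n-1}e^{-y\theta_j^{\max}}f_j(x)\,dy\,dx .$$ (b) If $\mathcal L'_i=\emptyset$ and $\beta_{i,j,j}$ is known, then $p^s_{i,j}=\mathbb 1[\lambda_{j,j}\beta_{i,j,j}/\nu\ge\xi_j^{\min}]$ and $r_{i,j}=\log(1+\lambda_{j,j}\beta_{i,j,j}/\nu)\,\mathbb 1[\lambda_{j,j}\beta_{i,j,j}/\nu\ge\xi_j^{\min}]$. (c) If $\mathcal L'_i=\emptyset$ and $\beta_{i,j,j}$ is unknown, then $p^s_{i,j}=\int_{\xi_j^{\min}\nu/\lambda_{j,j}}^\infty f_j(x)\,dx$ and $r_{i,j}=\int_{\xi_j^{\min}\nu/\lambda_{j,j}}^\infty\log(1+\lambda_{j,j}x/\nu)f_j(x)\,dx$ (in $[0,\infty]$). -/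

import Mathlib

open MeasureTheory ProbabilityTheory
open scoped ENNReal

noncomputable section

/-- Density of the Nakagami distribution with shape `m` and spread `w`
(the mean of the square is `w`). -/
def nakagamiPDFReal (m w x : ℝ) : ℝ :=
  if 0 < x then
    2 * m ^ m / (Real.Gamma m * w ^ m) * x ^ (2 * m - 1) * Real.exp (-(m / w) * x ^ 2)
  else 0

/-- The Nakagami distribution with shape `m` and spread `w`. -/
def nakagamiMeasure (m w : ℝ) : Measure ℝ :=
  volume.withDensity fun x => ENNReal.ofReal (nakagamiPDFReal m w x)

/-- Law of the power gain of a normalized Nakagami fading channel with parameter `m`: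
the law of the square of a Nakagami distributed envelope with shape `m` and spread `1`. -/
def nakagamiPowerLaw (m : ℝ) : Measure ℝ :=
  (nakagamiMeasure m 1).map fun x => x ^ 2

/-- The lower incomplete gamma function. -/
def lowerGamma (s x : ℝ) : ℝ :=
  ∫ t in (0 : ℝ)..x, t ^ (s - 1) * Real.exp (-t)

/-- The deterministic data seen by one link `j` on one channel, for links indexed by `ι`. -/
structure LinkModel (ι : Type*) [DecidableEq ι] where
  /-- the links that access the channel -/
  active : Finset ι
  /-- the link under consideration -/
  j : ι
  j_mem : j ∈ active
  /-- the active links whose small-scale fading gain towards the receiver of `j` is not known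
  (it contains `j` itself iff the signal gain is not known) -/
  unknown : Finset ι
  unknown_subset : unknown ⊆ active
  /-- transmit power times large-scale fading gain, from the transmitter of `z` to the
  receiver of `j` -/
  lam : ι → ℝ
  lam_pos : ∀ z ∈ active, 0 < lam z
  /-- the values of the known small-scale fading gains -/
  knownGain : ι → ℝ
  knownGain_nonneg : ∀ z ∈ active \ unknown, 0 ≤ knownGain z
  /-- Nakagami parameters of the interference links with unknown gain -/
  m : ι → ℝ
  m_pos : ∀ z ∈ unknown.erase j, 0 < m z
  /-- noise variance -/
  noise : ℝ
  noise_pos : 0 < noise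
  /-- minimum SINR requirement of link `j` -/
  xiMin : ℝ
  xiMin_pos : 0 < xiMin
  /-- density of the small-scale fading gain of the signal link `j` (only used if that gain is
  not known) -/
  f : ℝ → ℝ
  f_measurable : Measurable f
  f_nonneg : ∀ x, 0 ≤ f x

namespace LinkModel

variable {ι : Type*} [DecidableEq ι] (M : LinkModel ι)

/-- The interfering links with unknown small-scale fading gain. -/
def interferers : Finset ι := M.unknown.erase M.j

section Random

variable {Ω : Type*} [MeasurableSpace Ω]

/-- Distributional assumptions on the unknown gains: independence, arbitrary fading with density
`f` for the signal link, and Nakagami fading for the interference links. -/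
structure Fading (P : Measure Ω) (β : ι → Ω → ℝ) : Prop where
  signal : M.j ∈ M.unknown →
    HasLaw (β M.j) (volume.withDensity fun x => ENNReal.ofReal (M.f x)) P
  interference : ∀ z ∈ M.interferers, HasLaw (β z) (nakagamiPowerLaw (M.m z)) P
  indep : iIndepFun (fun z : M.unknown => β z) P

/-- The small-scale fading gain of link `z`: random if unknown, the known value otherwise. -/
def gain (β : ι → Ω → ℝ) (z : ι) (ω : Ω) : ℝ :=
  if z ∈ M.unknown then β z ω else M.knownGain z

/-- The received SINR of link `j`. -/
def sinr (β : ι → Ω → ℝ) (ω : Ω) : ℝ :=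
  M.lam M.j * M.gain β M.j ω /
    (M.noise + ∑ z ∈ M.active.erase M.j, M.lam z * M.gain β z ω)

/-- The event of a successful transmission. -/
def success (β : ι → Ω → ℝ) : Set Ω := {ω | M.xiMin ≤ M.sinr β ω}

/-- The successful transmission probability. -/
def successProb (P : Measure Ω) (β : ι → Ω → ℝ) : ℝ := P.real (M.success β)

/-- The expected rate, an element of `[0, ∞]`: the conditional expectation of
`log (1 + SINR)` (logarithm to base `b`) given success, times the success probability. -/
def expectedRate (b : ℝ) (P : Measure Ω) (β : ι → Ω → ℝ) : ℝ≥0∞ :=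
  (∫⁻ ω, ENNReal.ofReal (Real.logb b (1 + M.sinr β ω)) ∂P[|M.success β]) * P (M.success β)

end Random

/-- Power of the noise plus the interference with known gain. -/
def nu : ℝ :=
  M.noise + ∑ z ∈ M.active.erase M.j \ M.interferers, M.lam z * M.knownGain z

/-- Rate parameter of the Gamma distributed received power of interferer `z`. -/
def rate (z : ι) : ℝ := M.m z / M.lam z

/-- The largest rate parameter among the interferers with unknown gain. -/
def thetaMax : ℝ := ⨆ z : M.interferers, M.rate z

/-- The sum of the Nakagami parameters. -/
def rho : ℝ := ∑ z ∈ M.interferers, M.m z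

/-- The Moschopoulos coefficients: `δ₀ = 1` and
`δₙ = (1 / n) ∑_{l = 1}^n [∑_z m_z (1 - rate_z / θmax) ^ l] δ_{n - l}`. -/
def delta : ℕ → ℝ
  | 0 => 1
  | n + 1 => 1 / ((n : ℝ) + 1) * ∑ l : Fin (n + 1),
      (∑ z ∈ M.interferers, M.m z * (1 - M.rate z / M.thetaMax) ^ ((l : ℕ) + 1)) *
        delta (n - l)
  termination_by n => n
  decreasing_by omega

/-- The product `∏_z rate_z ^ m_z`. -/
def rateProd : ℝ := ∏ z ∈ M.interferers, M.rate z ^ M.m z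

/-- The smallest signal gain with which link `j` succeeds without unknown interference. -/
def threshold : ℝ := M.xiMin * M.nu / M.lam M.j

/-- The largest unknown interference tolerated at signal gain `x` (if nonnegative). -/
def margin (x : ℝ) : ℝ := M.lam M.j * x / M.xiMin - M.nu

/-- The tolerated unknown interference, for known signal gain. -/
def eta : ℝ := max 0 (M.margin (M.knownGain M.j))

/-- The coefficient `C` of the `n`-th term of the success probability. -/
def coeffC (n : ℕ) : ℝ :=
  if M.j ∈ M.unknown then
    ∫ x in Set.Ioi M.threshold, lowerGamma (M.rho + n) (M.margin x * M.thetaMax) * M.f x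
  else lowerGamma (M.rho + n) (M.eta * M.thetaMax)

/-- The integrand in `y` of the integrals `μ`, at signal gain `x`. -/
def muKernel (n : ℕ) (x y : ℝ) : ℝ :=
  Real.log (1 + M.lam M.j * x / (M.nu + y)) * y ^ (M.rho + n - 1) *
    Real.exp (-(y * M.thetaMax))

/-- The integral `μ_{ρ + n - 1}`, an element of `[0, ∞]`. -/
def mu (n : ℕ) : ℝ≥0∞ :=
  if M.j ∈ M.unknown then
    ∫⁻ x in Set.Ioi M.threshold, ∫⁻ y in Set.Ioc 0 (M.margin x),
      ENNReal.ofReal (M.muKernel n x y * M.f x)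
  else
    ∫⁻ y in Set.Ioc 0 M.eta, ENNReal.ofReal (M.muKernel n (M.knownGain M.j) y)

end LinkModel

end

/-!
Every quantity in the statement is the expectation, over the event of success, of a function of the
SINR: the constant `1` for the success probability and `log (1 + SINR)` for the rate. The SINR is
a function of the signal gain and of the total power `Y` of the interferers with unknown gain, and
these two are independent, so everything follows from the law of `Y`.

The received power of one interferer is Gamma distributed (`map_const_mul_nakagamiPowerLaw`), with
a rate `r ≤ θmax`. Writing `exp (-r y) = exp (-θmax y) * exp ((θmax - r) y)` and expanding the
second factor into the exponential series turns its density into a mixture of Gamma kernels of the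
common rate `θmax` and of shapes `m, m + 1, …`, whose weights are the coefficients of
`(1 - (θmax - r) X) ^ (-m)` (`gammaKernel_eq_gammaMixture`). Gamma kernels of equal rate form a
convolution semigroup in the shape, which is the Beta integral (`lconvolution_gammaKernel`); hence
independent summation multiplies the weight series (`lconvolution_gammaMixture`,
`hasLaw_sum_gamma`). The product of the series satisfies a linear differential equation, with the
sum of the logarithmic derivatives as coefficient, and its coefficientwise form is the recursion of
the `δ n`, so that the `n`-th weight is `δ n * θmax ^ n` (`coeff_prod_negBinomialSeries`).

Since all weights are nonnegative, expectations can be taken termwise in `[0, ∞]`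
(`setLIntegral_success_eq_tsum`). The success event confines `Y` to `(0, margin x]`, which
produces the lower incomplete Gamma function for the success probability and the integrals `μ` for
the rate.
-/

/-! ### Gamma kernels and their mixtures -/

/-- The kernel `y ^ (s - 1) * exp (-y θ) / Γ(s)` on the positive half-line, extended by zero.
It is the Gamma density of shape `s` and rate `θ` without the factor `θ ^ s`, which makes it
multiplicative in the shape under convolution without any constant. -/
noncomputable def gammaKernel (θ s y : ℝ) : ℝ≥0∞ :=
  ENNReal.ofReal (if 0 < y then y ^ (s - 1) * Real.exp (-(y * θ)) / Real.Gamma s else 0)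

@[fun_prop]
lemma measurable_gammaKernel (θ s : ℝ) : Measurable (gammaKernel θ s) := by
  unfold gammaKernel
  exact (Measurable.ite measurableSet_Ioi (by fun_prop) measurable_const).ennreal_ofReal

lemma gammaKernel_of_nonpos {θ s y : ℝ} (hy : y ≤ 0) : gammaKernel θ s y = 0 := by
  simp [gammaKernel, not_lt.2 hy]

lemma gammaKernel_of_pos {θ s y : ℝ} (hy : 0 < y) :
    gammaKernel θ s y = ENNReal.ofReal (y ^ (s - 1) * Real.exp (-(y * θ)) / Real.Gamma s) := by
  simp [gammaKernel, hy]

/-- After rescaling to the unit interval, the integrand of the convolution of two Gamma kernels is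
a multiple of a Beta density. -/
lemma gammaKernel_mul_gammaKernel {θ a b x : ℝ} (ha : 0 < a) (hb : 0 < b) (hx : 0 < x) (y : ℝ) :
    gammaKernel θ a y * gammaKernel θ b (-y + x) =
      ENNReal.ofReal (x ^ (a + b - 2) * Real.exp (-(x * θ)) / Real.Gamma (a + b)) *
        betaPDF a b (x⁻¹ * y) := by
  rcases le_or_gt y 0 with hy | hy
  · rw [gammaKernel_of_nonpos hy, betaPDF_eq_zero_of_nonpos
      (mul_nonpos_of_nonneg_of_nonpos (inv_nonneg.2 hx.le) hy)]
    simp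
  rcases le_or_gt x y with hxy | hxy
  · rw [gammaKernel_of_nonpos (y := -y + x) (by linarith), betaPDF_eq_zero_of_one_le
      (by rw [inv_mul_eq_div]; exact (one_le_div hx).2 hxy)]
    simp
  have hd : 0 < x - y := sub_pos.2 hxy
  have hlt : x⁻¹ * y < 1 := by rw [inv_mul_eq_div]; exact (div_lt_one hx).2 hxy
  have hGa := Real.Gamma_pos_of_pos ha
  have hGb := Real.Gamma_pos_of_pos hb
  have hGab := Real.Gamma_pos_of_pos (add_pos ha hb)
  rw [gammaKernel_of_pos hy, gammaKernel_of_pos (by linarith),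
    betaPDF_of_pos_lt_one (by positivity) hlt,
    ← ENNReal.ofReal_mul (by positivity), ← ENNReal.ofReal_mul (by positivity)]
  congr 1
  have h1 : 1 - x⁻¹ * y = x⁻¹ * (x - y) := by field_simp
  have h2 : x ^ (a + b - 2) = x ^ (a - 1) * x ^ (b - 1) := by
    rw [← Real.rpow_add hx]; congr 1; ring
  have h3 : Real.exp (-(x * θ)) = Real.exp (-(y * θ)) * Real.exp (-((x - y) * θ)) := by
    rw [← Real.exp_add]; congr 1; ring
  rw [neg_add_eq_sub, h1, Real.mul_rpow (by positivity) hy.le,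
    Real.mul_rpow (by positivity) hd.le, Real.inv_rpow hx.le, Real.inv_rpow hx.le, h2, h3, beta]
  have : 0 < x ^ (a - 1) := by positivity
  have : 0 < x ^ (b - 1) := by positivity
  field_simp

/-- Gamma kernels of equal rate form a convolution semigroup in the shape. -/
lemma lconvolution_gammaKernel {θ a b : ℝ} (ha : 0 < a) (hb : 0 < b) (x : ℝ) :
    ∫⁻ y, gammaKernel θ a y * gammaKernel θ b (-y + x) = gammaKernel θ (a + b) x := by
  rcases le_or_gt x 0 with hx | hx
  · rw [gammaKernel_of_nonpos hx]
    refine (lintegral_congr fun y => ?_).trans lintegral_zero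
    rcases le_or_gt y 0 with hy | hy
    · simp [gammaKernel_of_nonpos hy]
    · simp [gammaKernel_of_nonpos (show -y + x ≤ 0 by linarith)]
  have hmeas : Measurable (betaPDF a b) := (measurable_betaPDFReal a b).ennreal_ofReal
  have hscale : ∫⁻ y, betaPDF a b (x⁻¹ * y) = ENNReal.ofReal x := by
    rw [← lintegral_map hmeas (measurable_const_mul x⁻¹),
      Real.map_volume_mul_left (inv_ne_zero hx.ne'), lintegral_smul_measure,
      lintegral_betaPDF_eq_one ha hb]
    simp [abs_of_pos hx]
  have hG := Real.Gamma_pos_of_pos (add_pos ha hb)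
  simp_rw [gammaKernel_mul_gammaKernel ha hb hx]
  rw [lintegral_const_mul _ (by fun_prop), hscale, ← ENNReal.ofReal_mul (by positivity),
    gammaKernel_of_pos hx]
  congr 1
  have : x ^ (a + b - 1) = x ^ (a + b - 2) * x := by
    nth_rw 3 [← Real.rpow_one x]
    rw [← Real.rpow_add hx]; congr 1; ring
  rw [this]; ring

/-- The mixture of the Gamma kernels of shapes `s`, `s + 1`, `s + 2`, … weighted by the
coefficients of a power series. -/
noncomputable def gammaMixture (θ s : ℝ) (F : PowerSeries ℝ) (y : ℝ) : ℝ≥0∞ :=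
  ∑' n : ℕ, ENNReal.ofReal (F.coeff n) * gammaKernel θ (s + n) y

@[fun_prop]
lemma measurable_gammaMixture (θ s : ℝ) (F : PowerSeries ℝ) :
    Measurable (gammaMixture θ s F) := by
  unfold gammaMixture
  fun_prop

lemma gammaMixture_of_nonpos {θ s y : ℝ} (F : PowerSeries ℝ) (hy : y ≤ 0) :
    gammaMixture θ s F y = 0 := by
  simp [gammaMixture, gammaKernel_of_nonpos hy]

lemma tsum_tsum_eq_tsum_sum_antidiagonal (f : ℕ → ℕ → ℝ≥0∞) :
    ∑' n, ∑' k, f n k = ∑' N : ℕ, ∑ p ∈ Finset.HasAntidiagonal.antidiagonal N, f p.1 p.2 := by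
  rw [← ENNReal.tsum_prod, ← Finset.HasAntidiagonal.sigmaAntidiagonalEquivProd.tsum_eq,
    ENNReal.tsum_sigma']
  refine tsum_congr fun N => ?_
  rw [tsum_fintype,
    ← Finset.sum_coe_sort (Finset.HasAntidiagonal.antidiagonal N) fun p => f p.1 p.2]
  rfl

/-- Convolving Gamma mixtures of equal rate multiplies their power series. -/
lemma lconvolution_gammaMixture {θ a b : ℝ} (ha : 0 < a) (hb : 0 < b) {F G : PowerSeries ℝ}
    (hF : ∀ n, 0 ≤ F.coeff n) (hG : ∀ n, 0 ≤ G.coeff n) (x : ℝ) :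
    ∫⁻ y, gammaMixture θ a F y * gammaMixture θ b G (-y + x) =
      gammaMixture θ (a + b) (F * G) x := by
  have hterm (n k : ℕ) : ∫⁻ y, (ENNReal.ofReal (F.coeff n) * gammaKernel θ (a + n) y) *
      (ENNReal.ofReal (G.coeff k) * gammaKernel θ (b + k) (-y + x)) =
      ENNReal.ofReal (F.coeff n * G.coeff k) * gammaKernel θ (a + b + (n + k : ℕ)) x := by
    rw [ENNReal.ofReal_mul (hF n), show a + b + ((n + k : ℕ) : ℝ) = (a + n) + (b + k) by
      push_cast; ring, ← lconvolution_gammaKernel (by positivity) (by positivity),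
      ← lintegral_const_mul _ (by fun_prop)]
    exact lintegral_congr fun y => by ring
  unfold gammaMixture
  simp_rw [← ENNReal.tsum_mul_right, ← ENNReal.tsum_mul_left]
  rw [lintegral_tsum (fun n => by fun_prop)]
  have hinner (n : ℕ) : ∫⁻ y, ∑' k : ℕ, ENNReal.ofReal (F.coeff n) * gammaKernel θ (a + n) y *
      (ENNReal.ofReal (G.coeff k) * gammaKernel θ (b + k) (-y + x)) =
      ∑' k : ℕ, ENNReal.ofReal (F.coeff n * G.coeff k) *
        gammaKernel θ (a + b + (n + k : ℕ)) x := by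
    rw [lintegral_tsum fun k => by fun_prop]
    exact tsum_congr (hterm n)
  rw [tsum_congr hinner]
  rw [tsum_tsum_eq_tsum_sum_antidiagonal]
  refine tsum_congr fun N => ?_
  rw [PowerSeries.coeff_mul, ENNReal.ofReal_sum_of_nonneg fun p _ => mul_nonneg (hF _) (hG _),
    Finset.sum_mul]
  refine Finset.sum_congr rfl fun p hp => ?_
  rw [Finset.HasAntidiagonal.mem_antidiagonal.1 hp]

/-! ### Negative binomial power series -/

/-- The power series `∑ Γ(m + k) / (Γ(m) k!) d ^ k X ^ k` of `(1 - d X) ^ (-m)`. -/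
noncomputable def negBinomialSeries (m d : ℝ) : PowerSeries ℝ :=
  PowerSeries.mk fun k => Real.Gamma (m + k) / (Real.Gamma m * k.factorial) * d ^ k

lemma coeff_negBinomialSeries_nonneg {m d : ℝ} (hm : 0 < m) (hd : 0 ≤ d) (k : ℕ) :
    0 ≤ (negBinomialSeries m d).coeff k := by
  have := Real.Gamma_pos_of_pos hm
  have := Real.Gamma_pos_of_pos (show 0 < m + k by positivity)
  rw [negBinomialSeries, PowerSeries.coeff_mk]
  positivity

/-- The logarithmic derivative of `(1 - d X) ^ (-m)` is `m d / (1 - d X)`. -/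
lemma derivative_negBinomialSeries {m d : ℝ} (hm : 0 < m) :
    PowerSeries.derivative ℝ (negBinomialSeries m d) =
      PowerSeries.mk (fun l => m * d ^ (l + 1)) * negBinomialSeries m d := by
  -- Multiplied by `1 - d X`, the claim reduces to the functional equation of the Gamma function.
  have hgeom : (1 - PowerSeries.C d * PowerSeries.X) * PowerSeries.mk (fun l => m * d ^ (l + 1)) =
      PowerSeries.C (m * d) := by
    ext n
    rcases n with _ | n
    · simp [sub_mul, mul_assoc]
    · simp [sub_mul, mul_assoc, PowerSeries.coeff_succ_X_mul]
      ring
  have hne : (1 - PowerSeries.C d * PowerSeries.X : PowerSeries ℝ) ≠ 0 := by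
    intro h
    have := congrArg (PowerSeries.coeff 0) h
    simp at this
  refine mul_left_cancel₀ hne ?_
  rw [← mul_assoc, hgeom]
  have hG := Real.Gamma_pos_of_pos hm
  have hstep (k : ℕ) : Real.Gamma (m + (k + 1 : ℕ)) = (m + k) * Real.Gamma (m + k) := by
    rw [← Real.Gamma_add_one (by positivity)]; push_cast; ring_nf
  ext n
  rcases n with _ | n
  · have := hstep 0
    simp only [Nat.cast_zero, zero_add, add_zero, Nat.cast_one] at this
    simp only [sub_mul, one_mul, mul_assoc, map_sub, PowerSeries.coeff_C_mul,
      PowerSeries.coeff_zero_X_mul, PowerSeries.coeff_derivative, negBinomialSeries,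
      PowerSeries.coeff_mk]
    simp [this]
    field_simp
  · have h1 := hstep (n + 1)
    simp only [sub_mul, one_mul, mul_assoc, map_sub, PowerSeries.coeff_C_mul,
      PowerSeries.coeff_succ_X_mul, PowerSeries.coeff_derivative, negBinomialSeries,
      PowerSeries.coeff_mk, h1, Nat.factorial_succ (n + 1)]
    push_cast
    field_simp
    ring

/-- Logarithmic derivatives add up in a product. -/
lemma derivative_prod_of_logDeriv {κ : Type*} (S : Finset κ) {F L : κ → PowerSeries ℝ}
    (h : ∀ z ∈ S, PowerSeries.derivative ℝ (F z) = L z * F z) :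
    PowerSeries.derivative ℝ (∏ z ∈ S, F z) = (∑ z ∈ S, L z) * ∏ z ∈ S, F z := by
  classical
  induction S using Finset.induction_on with
  | empty => simp
  | insert a S ha ih =>
    rw [Finset.prod_insert ha, Finset.sum_insert ha, Derivation.leibniz, smul_eq_mul, smul_eq_mul,
      ih fun z hz => h z (Finset.mem_insert_of_mem hz), h a (Finset.mem_insert_self a S)]
    ring

lemma coeff_prod_nonneg {κ : Type*} (S : Finset κ) {F : κ → PowerSeries ℝ}
    (h : ∀ z ∈ S, ∀ n, 0 ≤ (F z).coeff n) (n : ℕ) : 0 ≤ (∏ z ∈ S, F z).coeff n := by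
  classical
  induction S using Finset.induction_on generalizing n with
  | empty => rw [Finset.prod_empty, PowerSeries.coeff_one]; split_ifs <;> norm_num
  | insert a S ha ih =>
    rw [Finset.prod_insert ha, PowerSeries.coeff_mul]
    exact Finset.sum_nonneg fun p _ => mul_nonneg (h a (Finset.mem_insert_self a S) _)
      (ih (fun z hz => h z (Finset.mem_insert_of_mem hz)) _)

/-- A Gamma density of rate `r ≤ θ` is a mixture of Gamma kernels of the larger rate `θ`: expand
`exp (-r y) = exp (-θ y) * exp ((θ - r) y)` into the exponential series. -/
lemma gammaKernel_eq_gammaMixture {θ r m : ℝ} (hm : 0 < m) (hr : r ≤ θ) (y : ℝ) :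
    gammaKernel r m y = gammaMixture θ m (negBinomialSeries m (θ - r)) y := by
  rcases le_or_gt y 0 with hy | hy
  · rw [gammaKernel_of_nonpos hy, gammaMixture_of_nonpos _ hy]
  have hd : 0 ≤ θ - r := sub_nonneg.2 hr
  have hG := Real.Gamma_pos_of_pos hm
  have hsum : HasSum (fun k : ℕ => y ^ (m - 1) * Real.exp (-(y * θ)) / Real.Gamma m *
      (((θ - r) * y) ^ k / k.factorial))
      (y ^ (m - 1) * Real.exp (-(y * θ)) / Real.Gamma m * Real.exp ((θ - r) * y)) := by
    refine HasSum.mul_left _ ?_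
    rw [Real.exp_eq_exp_ℝ]
    simpa only [div_eq_inv_mul, smul_eq_mul] using
      NormedSpace.exp_series_hasSum_exp' (𝕂 := ℝ) ((θ - r) * y)
  rw [gammaKernel_of_pos hy, show Real.exp (-(y * r)) =
    Real.exp (-(y * θ)) * Real.exp ((θ - r) * y) by rw [← Real.exp_add]; congr 1; ring]
  rw [show y ^ (m - 1) * (Real.exp (-(y * θ)) * Real.exp ((θ - r) * y)) / Real.Gamma m =
    y ^ (m - 1) * Real.exp (-(y * θ)) / Real.Gamma m * Real.exp ((θ - r) * y) by ring,
    ← hsum.tsum_eq, ENNReal.ofReal_tsum_of_nonneg (fun k => by positivity) hsum.summable]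
  refine tsum_congr fun k => ?_
  have hGk := Real.Gamma_pos_of_pos (show 0 < m + k by positivity)
  rw [gammaKernel_of_pos hy, ← ENNReal.ofReal_mul (coeff_negBinomialSeries_nonneg hm hd k),
    negBinomialSeries, PowerSeries.coeff_mk, show m + (k : ℝ) - 1 = (m - 1) + k by ring,
    Real.rpow_add hy, Real.rpow_natCast,
    mul_pow]
  congr 1
  field_simp

/-! ### Laws of the interference powers -/

/-- Change of variables `y = l x ^ 2` on the positive half-line. -/
lemma setLIntegral_Ioi_comp_const_mul_sq {l : ℝ} (hl : 0 < l) (u : ℝ → ℝ≥0∞) :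
    ∫⁻ y in Set.Ioi 0, u y =
      ∫⁻ x in Set.Ioi 0, ENNReal.ofReal (2 * l * x) * u (l * x ^ 2) := by
  have himage : (fun x : ℝ => l * x ^ 2) '' Set.Ioi 0 = Set.Ioi 0 := by
    ext y
    simp only [Set.mem_image, Set.mem_Ioi]
    refine ⟨?_, fun hy => ⟨√(y / l), by positivity, ?_⟩⟩
    · rintro ⟨x, hx, rfl⟩
      positivity
    · rw [Real.sq_sqrt (by positivity)]
      field_simp
  conv_lhs => rw [← himage]
  refine lintegral_image_eq_lintegral_deriv_mul_of_monotoneOn measurableSet_Ioi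
    (fun x _ => ?_) (fun x hx y _ hxy => ?_) u
  · exact (((hasDerivAt_pow 2 x).const_mul l).congr_deriv (by
      norm_num; ring)).hasDerivWithinAt
  · have : (0 : ℝ) ≤ x := le_of_lt hx
    gcongr

/-- A scaled Nakagami power gain has a Gamma density. -/
lemma map_const_mul_nakagamiPowerLaw {m l : ℝ} (hm : 0 < m) (hl : 0 < l) :
    (nakagamiPowerLaw m).map (fun x => l * x) =
      volume.withDensity fun y => ENNReal.ofReal ((m / l) ^ m) * gammaKernel (m / l) m y := by
  have hG := Real.Gamma_pos_of_pos hm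
  have hpdf : Measurable (nakagamiPDFReal m 1) :=
    Measurable.ite measurableSet_Ioi (by fun_prop) measurable_const
  refine Measure.ext_of_lintegral _ fun φ hφ => ?_
  rw [nakagamiPowerLaw, nakagamiMeasure, Measure.map_map (by fun_prop) (by fun_prop),
    lintegral_map hφ (by fun_prop), lintegral_withDensity_eq_lintegral_mul _ (by fun_prop)
      (by fun_prop), lintegral_withDensity_eq_lintegral_mul _ (by fun_prop) hφ]
  have hleft : ∀ x ∉ Set.Ioi (0 : ℝ), ((fun x => ENNReal.ofReal (nakagamiPDFReal m 1 x)) *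
      fun x => φ (((fun x => l * x) ∘ fun x => x ^ 2) x)) x = 0 := by
    intro x hx
    simp [nakagamiPDFReal, show ¬ 0 < x from hx]
  have hright : ∀ y ∉ Set.Ioi (0 : ℝ), ((fun y => ENNReal.ofReal ((m / l) ^ m) *
      gammaKernel (m / l) m y) * φ) y = 0 := by
    intro y hy
    simp [gammaKernel_of_nonpos (not_lt.1 hy)]
  rw [← setLIntegral_eq_of_support_subset (Function.support_subset_iff'.2 hleft),
    ← setLIntegral_eq_of_support_subset (Function.support_subset_iff'.2 hright)]
  conv_rhs => rw [setLIntegral_Ioi_comp_const_mul_sq hl]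
  refine setLIntegral_congr_fun measurableSet_Ioi fun x (hx : 0 < x) => ?_
  simp only [Pi.mul_apply, Function.comp_apply]
  rw [gammaKernel_of_pos (by positivity), ← mul_assoc, ← mul_assoc,
    ← ENNReal.ofReal_mul (by positivity), ← ENNReal.ofReal_mul (by positivity)]
  congr 2
  have h1 : l * x ^ 2 * (m / l) = m * x ^ 2 := by field_simp
  have h2 : (x ^ 2 : ℝ) ^ (m - 1) * x = x ^ (2 * m - 1) := by
    rw [← Real.rpow_natCast, ← Real.rpow_mul hx.le]
    nth_rw 2 [← Real.rpow_one x]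
    rw [← Real.rpow_add hx]
    congr 1
    push_cast
    ring
  have h3 : l ^ (m - 1) * l = l ^ m := by
    nth_rw 2 [← Real.rpow_one l]
    rw [← Real.rpow_add hl]
    congr 1
    ring
  have : 0 < l ^ m := by positivity
  rw [nakagamiPDFReal, if_pos hx, h1, Real.mul_rpow hl.le (by positivity),
    Real.div_rpow hm.le hl.le, ← h2, Real.one_rpow, div_one, ← neg_mul]
  field_simp
  rw [← h3, mul_comm]

/-- The sum of independent Gamma variables of shapes `m z` and rates `r z ≤ θ` has a density that
is a mixture of Gamma kernels of rate `θ`. -/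
lemma hasLaw_sum_gamma {κ Ω : Type*} [MeasurableSpace Ω] {P : Measure Ω} [IsProbabilityMeasure P]
    {X : κ → Ω → ℝ} (hind : iIndepFun X P) (hX : ∀ z, AEMeasurable (X z) P) {m r : κ → ℝ} {θ : ℝ}
    {S : Finset κ} (hS : S.Nonempty) (hm : ∀ z ∈ S, 0 < m z) (hr0 : ∀ z ∈ S, 0 ≤ r z)
    (hr : ∀ z ∈ S, r z ≤ θ)
    (hlaw : ∀ z ∈ S, HasLaw (X z)
      (volume.withDensity fun y => ENNReal.ofReal (r z ^ m z) * gammaKernel (r z) (m z) y) P) :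
    HasLaw (fun ω => ∑ z ∈ S, X z ω)
      (volume.withDensity fun y => ENNReal.ofReal (∏ z ∈ S, r z ^ m z) *
        gammaMixture θ (∑ z ∈ S, m z) (∏ z ∈ S, negBinomialSeries (m z) (θ - r z)) y) P := by
  classical
  induction hS using Finset.Nonempty.cons_induction with
  | singleton a =>
    have := hlaw a (Finset.mem_singleton_self a)
    simp only [Finset.sum_singleton, Finset.prod_singleton]
    simpa only [gammaKernel_eq_gammaMixture (hm a (Finset.mem_singleton_self a))
      (hr a (Finset.mem_singleton_self a))] using this
  | cons a S ha hS ih =>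
    have hmem : ∀ z ∈ S, z ∈ Finset.cons a S ha := fun z hz => Finset.mem_cons_of_mem hz
    have hself : a ∈ Finset.cons a S ha := Finset.mem_cons_self a S
    have hlS := ih (fun z hz => hm z (hmem z hz)) (fun z hz => hr0 z (hmem z hz))
      (fun z hz => hr z (hmem z hz)) (fun z hz => hlaw z (hmem z hz))
    have hla := hlaw a hself
    simp only [gammaKernel_eq_gammaMixture (hm a hself) (hr a hself)] at hla
    have hindep : IndepFun (X a) (fun ω => ∑ z ∈ S, X z ω) P := by
      have := (hind.indepFun_finsetSum_of_notMem₀ hX ha).symm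
      rwa [show ∑ z ∈ S, X z = fun ω => ∑ z ∈ S, X z ω by ext ω; simp] at this
    have hpa := hla.isProbabilityMeasure_iff.1 inferInstance
    have hpS := hlS.isProbabilityMeasure_iff.1 inferInstance
    have hadd := hindep.hasLaw_fun_add hla hlS
    rw [conv_withDensity_eq_lconvolution (by fun_prop) (by fun_prop)] at hadd
    simp only [Finset.sum_cons, Finset.prod_cons]
    convert hadd using 3 with y
    have hsum : 0 < ∑ z ∈ S, m z := Finset.sum_pos (fun z hz => hm z (hmem z hz)) hS
    have hcoeff : ∀ z ∈ Finset.cons a S ha, ∀ n,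
        0 ≤ (negBinomialSeries (m z) (θ - r z)).coeff n := fun z hz =>
      coeff_negBinomialSeries_nonneg (hm z hz) (sub_nonneg.2 (hr z hz))
    rw [lconvolution_def, ENNReal.ofReal_mul (Real.rpow_nonneg (hr0 a hself) _),
      ← lconvolution_gammaMixture (hm a hself) hsum (hcoeff a hself)
        (coeff_prod_nonneg S fun z hz => hcoeff z (hmem z hz)),
      ← lintegral_const_mul _ (by fun_prop)]
    exact lintegral_congr fun x => by ring

namespace LinkModel

variable {ι : Type*} [DecidableEq ι] (M : LinkModel ι)

lemma interferers_subset_erase : M.interferers ⊆ M.active.erase M.j :=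
  Finset.erase_subset_erase _ M.unknown_subset

lemma rate_pos {z : ι} (hz : z ∈ M.interferers) : 0 < M.rate z :=
  div_pos (M.m_pos z hz)
    (M.lam_pos z (Finset.mem_of_mem_erase (M.interferers_subset_erase hz)))

lemma rate_le_thetaMax {z : ι} (hz : z ∈ M.interferers) : M.rate z ≤ M.thetaMax :=
  le_ciSup (f := fun z : M.interferers => M.rate z) (Set.finite_range _).bddAbove ⟨z, hz⟩

lemma thetaMax_pos (h : M.interferers.Nonempty) : 0 < M.thetaMax :=
  let ⟨_, hz⟩ := h
  (M.rate_pos hz).trans_le (M.rate_le_thetaMax hz)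

lemma rho_pos (h : M.interferers.Nonempty) : 0 < M.rho := Finset.sum_pos M.m_pos h

lemma rateProd_pos : 0 < M.rateProd :=
  Finset.prod_pos fun _ hz => Real.rpow_pos_of_pos (M.rate_pos hz) _

lemma nu_pos : 0 < M.nu := by
  refine add_pos_of_pos_of_nonneg M.noise_pos (Finset.sum_nonneg fun z hz => ?_)
  obtain ⟨hz, hzi⟩ := Finset.mem_sdiff.1 hz
  obtain ⟨hzj, hza⟩ := Finset.mem_erase.1 hz
  have hzu : z ∉ M.unknown := fun h => hzi (Finset.mem_erase.2 ⟨hzj, h⟩)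
  exact mul_nonneg (M.lam_pos z hza).le (M.knownGain_nonneg z (Finset.mem_sdiff.2 ⟨hza, hzu⟩))

lemma lam_j_pos : 0 < M.lam M.j := M.lam_pos _ M.j_mem

lemma delta_nonneg (n : ℕ) : 0 ≤ M.delta n := by
  induction n using Nat.strong_induction_on with
  | _ n ih =>
    rcases n with _ | n
    · rw [delta]; exact zero_le_one
    · rw [delta]
      refine mul_nonneg (by positivity) (Finset.sum_nonneg fun l _ =>
        mul_nonneg (Finset.sum_nonneg fun z hz => mul_nonneg (M.m_pos z hz).le (pow_nonneg ?_ _))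
          (ih _ (by omega)))
      exact sub_nonneg.2 (div_le_one_of_le₀ (M.rate_le_thetaMax hz)
        (M.thetaMax_pos ⟨z, hz⟩).le)

/-- The Moschopoulos recursion is the coefficientwise form of the differential equation
`F' = (∑ z, m z d z / (1 - d z X)) F` of `F = ∏ z, (1 - d z X) ^ (-m z)`, where
`d z = θmax - rate z`. -/
lemma coeff_prod_negBinomialSeries (h : M.interferers.Nonempty) (n : ℕ) :
    (∏ z ∈ M.interferers, negBinomialSeries (M.m z) (M.thetaMax - M.rate z)).coeff n =
      M.delta n * M.thetaMax ^ n := by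
  have hθ := M.thetaMax_pos h
  have hder := derivative_prod_of_logDeriv M.interferers fun z hz =>
    derivative_negBinomialSeries (d := M.thetaMax - M.rate z) (M.m_pos z hz)
  induction n using Nat.strong_induction_on with
  | _ n ih =>
    rcases n with _ | n
    · rw [delta, PowerSeries.coeff_zero_eq_constantCoeff_apply, map_prod,
        Finset.prod_eq_one fun z hz => ?_]
      · simp
      · have := Real.Gamma_pos_of_pos (M.m_pos z hz)
        rw [← PowerSeries.coeff_zero_eq_constantCoeff_apply, negBinomialSeries,
          PowerSeries.coeff_mk]
        simp [this.ne']
    · have hdelta : M.delta (n + 1) = 1 / ((n : ℝ) + 1) * ∑ k ∈ Finset.range (n + 1),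
          (∑ z ∈ M.interferers, M.m z * (1 - M.rate z / M.thetaMax) ^ (k + 1)) *
            M.delta (n - k) := by
        rw [delta, ← Fin.sum_univ_eq_sum_range fun k : ℕ =>
          (∑ z ∈ M.interferers, M.m z * (1 - M.rate z / M.thetaMax) ^ (k + 1)) * M.delta (n - k)]
      have hc := congrArg (PowerSeries.coeff n) hder
      rw [PowerSeries.coeff_derivative, PowerSeries.coeff_mul,
        Finset.Nat.sum_antidiagonal_eq_sum_range_succ_mk] at hc
      have hn : (n : ℝ) + 1 ≠ 0 := by positivity
      refine mul_right_cancel₀ hn (hc.trans ?_)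
      rw [hdelta, show ∀ a : ℝ, 1 / ((n : ℝ) + 1) * a * M.thetaMax ^ (n + 1) * ((n : ℝ) + 1) =
        a * M.thetaMax ^ (n + 1) by intro a; field_simp, Finset.sum_mul]
      refine Finset.sum_congr rfl fun k hk => ?_
      have hk : k ≤ n := Finset.mem_range_succ_iff.1 hk
      have hsum : ∑ z ∈ M.interferers, (PowerSeries.mk fun l =>
            M.m z * (M.thetaMax - M.rate z) ^ (l + 1)).coeff k =
          (∑ z ∈ M.interferers, M.m z * (1 - M.rate z / M.thetaMax) ^ (k + 1)) *
            M.thetaMax ^ (k + 1) := by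
        rw [Finset.sum_mul]
        refine Finset.sum_congr rfl fun z _ => ?_
        rw [PowerSeries.coeff_mk, mul_assoc, ← mul_pow, sub_mul, div_mul_cancel₀ _ hθ.ne', one_mul]
      have hpow : M.thetaMax ^ (n + 1) = M.thetaMax ^ (k + 1) * M.thetaMax ^ (n - k) := by
        rw [← pow_add]; congr 1; omega
      rw [ih (n - k) (by omega), map_sum, hsum, hpow]
      ring

/-! ### The interference of a link and its density -/

section Random

variable {Ω : Type*}

/-- The total received power of the interferers with unknown gain. -/
def interference (β : ι → Ω → ℝ) (ω : Ω) : ℝ := ∑ z ∈ M.interferers, M.lam z * β z ω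

/-- The SINR at signal gain `x` and unknown interference `y`. -/
noncomputable def sinrAt (x y : ℝ) : ℝ := M.lam M.j * x / (M.nu + y)

/-- A function `h` of the SINR, set to zero unless the transmission succeeds. -/
noncomputable def gated (h : ℝ → ℝ≥0∞) (x y : ℝ) : ℝ≥0∞ :=
  if M.xiMin ≤ M.sinrAt x y then h (M.sinrAt x y) else 0

/-- The density of the total unknown interference. -/
noncomputable def interferenceDensity (y : ℝ) : ℝ≥0∞ :=
  ENNReal.ofReal M.rateProd * gammaMixture M.thetaMax M.rho
    (∏ z ∈ M.interferers, negBinomialSeries (M.m z) (M.thetaMax - M.rate z)) y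

@[fun_prop]
lemma measurable_interferenceDensity : Measurable M.interferenceDensity := by
  unfold interferenceDensity
  fun_prop

lemma measurable_gated {h : ℝ → ℝ≥0∞} (hh : Measurable h) :
    Measurable fun p : ℝ × ℝ => M.gated h p.1 p.2 := by
  have hs : Measurable fun p : ℝ × ℝ => M.sinrAt p.1 p.2 := by
    unfold sinrAt
    fun_prop
  exact Measurable.ite (measurableSet_le measurable_const hs) (hh.comp hs) measurable_const

lemma sinr_eq_sinrAt (β : ι → Ω → ℝ) (ω : Ω) :
    M.sinr β ω = M.sinrAt (M.gain β M.j ω) (M.interference β ω) := by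
  have hunknown : ∑ z ∈ M.interferers, M.lam z * M.gain β z ω = M.interference β ω :=
    Finset.sum_congr rfl fun z hz => by rw [gain, if_pos (Finset.mem_of_mem_erase hz)]
  have hknown : ∑ z ∈ M.active.erase M.j \ M.interferers, M.lam z * M.gain β z ω =
      ∑ z ∈ M.active.erase M.j \ M.interferers, M.lam z * M.knownGain z :=
    Finset.sum_congr rfl fun z hz => by
      obtain ⟨hz, hzi⟩ := Finset.mem_sdiff.1 hz
      rw [gain, if_neg fun h => hzi (Finset.mem_erase.2 ⟨(Finset.mem_erase.1 hz).1, h⟩)]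
  rw [sinr, sinrAt, nu, ← Finset.sum_sdiff M.interferers_subset_erase, hunknown, hknown, add_assoc]

lemma interference_eq_zero (hne : M.interferers = ∅) (β : ι → Ω → ℝ) (ω : Ω) :
    M.interference β ω = 0 := by
  simp [interference, hne]

/-- The interference as a sum over the subtype of unknown links, on which independence is assumed;
the factor `1` at `j` is never used in this sum and keeps the signal gain unscaled. -/
lemma interference_eq_sum_scaled (β : ι → Ω → ℝ) :
    M.interference β = fun ω => ∑ z ∈ M.interferers.subtype (· ∈ M.unknown),
      (if (z : ι) = M.j then 1 else M.lam z) * β z ω := by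
  ext ω
  rw [Finset.sum_subtype_of_mem (s := M.interferers) (p := (· ∈ M.unknown))
    (fun z => (if z = M.j then 1 else M.lam z) * β z ω) fun z hz => Finset.mem_of_mem_erase hz]
  exact Finset.sum_congr rfl fun z hz => by rw [if_neg (Finset.ne_of_mem_erase hz)]

variable [MeasurableSpace Ω] {P : Measure Ω} {β : ι → Ω → ℝ}

lemma Fading.aemeasurable {M : LinkModel ι} (hβ : M.Fading P β) {z : ι} (hz : z ∈ M.unknown) :
    AEMeasurable (β z) P := by
  by_cases hj : z = M.j
  · subst hj
    exact (hβ.signal hz).aemeasurable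
  · exact (hβ.interference z (Finset.mem_erase.2 ⟨hj, hz⟩)).aemeasurable

lemma Fading.aemeasurable_interference {M : LinkModel ι} (hβ : M.Fading P β) :
    AEMeasurable (M.interference β) P :=
  Finset.aemeasurable_fun_sum _ fun _ hz =>
    (hβ.aemeasurable (Finset.mem_of_mem_erase hz)).const_mul _

lemma Fading.aemeasurable_gain {M : LinkModel ι} (hβ : M.Fading P β) :
    AEMeasurable (M.gain β M.j) P := by
  by_cases hj : M.j ∈ M.unknown
  · rw [show M.gain β M.j = β M.j from funext fun ω => if_pos hj]
    exact hβ.aemeasurable hj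
  · rw [show M.gain β M.j = fun _ => M.knownGain M.j from funext fun ω => if_neg hj]
    exact aemeasurable_const

/-- The received powers of the interferers with unknown gain and, if it is unknown, the signal gain
itself form an independent family. -/
lemma Fading.iIndepFun_scaled {M : LinkModel ι} (hβ : M.Fading P β) :
    iIndepFun (fun (z : M.unknown) ω => (if (z : ι) = M.j then 1 else M.lam z) * β z ω) P :=
  hβ.indep.comp (fun z x => (if (z : ι) = M.j then 1 else M.lam z) * x) fun _ => by fun_prop

lemma Fading.hasLaw_interference {M : LinkModel ι} [IsProbabilityMeasure P] (hβ : M.Fading P β)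
    (h : M.interferers.Nonempty) :
    HasLaw (M.interference β) (volume.withDensity M.interferenceDensity) P := by
  have hmem : ∀ z ∈ M.interferers, z ∈ M.unknown := fun z hz => Finset.mem_of_mem_erase hz
  have hS : (M.interferers.subtype (· ∈ M.unknown)).Nonempty := by
    obtain ⟨z, hz⟩ := h
    exact ⟨⟨z, hmem z hz⟩, Finset.mem_subtype.2 hz⟩
  have hlaw := hasLaw_sum_gamma (m := fun z : M.unknown => M.m z)
    (r := fun z : M.unknown => M.rate z) (θ := M.thetaMax) hβ.iIndepFun_scaled
    (fun z => (hβ.aemeasurable z.2).const_mul _) hS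
    (fun z hz => M.m_pos z (Finset.mem_subtype.1 hz))
    (fun z hz => (M.rate_pos (Finset.mem_subtype.1 hz)).le)
    (fun z hz => M.rate_le_thetaMax (Finset.mem_subtype.1 hz)) fun z hz => ?_
  · rw [← M.interference_eq_sum_scaled] at hlaw
    rw [Finset.sum_subtype_of_mem M.m hmem,
      Finset.prod_subtype_of_mem (fun z => M.rate z ^ M.m z) hmem,
      Finset.prod_subtype_of_mem (fun z => negBinomialSeries (M.m z) (M.thetaMax - M.rate z))
        hmem] at hlaw
    exact hlaw
  · have hz := Finset.mem_subtype.1 hz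
    have hl := M.lam_pos z (Finset.mem_of_mem_erase (M.interferers_subset_erase hz))
    rw [if_neg (Finset.ne_of_mem_erase hz)]
    have hlaw := hβ.interference z hz
    refine ⟨hlaw.aemeasurable.const_mul _, ?_⟩
    rw [rate, ← map_const_mul_nakagamiPowerLaw (M.m_pos z hz) hl, ← hlaw.map_eq,
      AEMeasurable.map_map_of_aemeasurable (by fun_prop) hlaw.aemeasurable]
    rfl

lemma Fading.indepFun_signal_interference {M : LinkModel ι} [IsProbabilityMeasure P]
    (hβ : M.Fading P β) (hj : M.j ∈ M.unknown) : IndepFun (β M.j) (M.interference β) P := by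
  have hnot : (⟨M.j, hj⟩ : M.unknown) ∉ M.interferers.subtype (· ∈ M.unknown) := by
    intro h
    have h : M.j ∈ M.unknown.erase M.j := Finset.mem_subtype.1 h
    exact Finset.notMem_erase _ _ h
  have hind := (hβ.iIndepFun_scaled.indepFun_finsetSum_of_notMem₀
    (fun z => (hβ.aemeasurable z.2).const_mul _) hnot).symm
  have hsignal : (fun ω => (if M.j = M.j then 1 else M.lam M.j) * β M.j ω) = β M.j := by
    ext ω
    rw [if_pos rfl, one_mul]
  have hsum : (∑ z ∈ M.interferers.subtype (· ∈ M.unknown),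
      fun ω => (if (z : ι) = M.j then 1 else M.lam z) * β z ω) = M.interference β := by
    rw [M.interference_eq_sum_scaled]
    ext ω
    rw [Finset.sum_apply]
  rw [hsum] at hind
  exact hsignal ▸ hind

/-! ### Expectations over the event of success -/

lemma Fading.setLIntegral_success {M : LinkModel ι} (hβ : M.Fading P β) (h : ℝ → ℝ≥0∞) :
    ∫⁻ ω in M.success β, h (M.sinr β ω) ∂P =
      ∫⁻ ω, M.gated h (M.gain β M.j ω) (M.interference β ω) ∂P := by
  have hsinr : AEMeasurable (M.sinr β) P := by
    have h1 := hβ.aemeasurable_gain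
    have h2 := hβ.aemeasurable_interference
    rw [show M.sinr β = _ from funext (M.sinr_eq_sinrAt β)]
    unfold sinrAt
    fun_prop
  have hset : NullMeasurableSet (M.success β) P :=
    hsinr.nullMeasurableSet_preimage measurableSet_Ici
  rw [← lintegral_indicator₀ hset]
  refine lintegral_congr fun ω => ?_
  simp only [Set.indicator, success, gated, Set.mem_ofPred_eq, sinr_eq_sinrAt]

/-- Conditioning on success and multiplying by the success probability is integrating over the
event of success; this includes the case of a null event. -/
lemma expectedRate_eq_setLIntegral [IsFiniteMeasure P] (b : ℝ) :
    M.expectedRate b P β =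
      ∫⁻ ω in M.success β, ENNReal.ofReal (Real.logb b (1 + M.sinr β ω)) ∂P := by
  rw [expectedRate, ProbabilityTheory.cond, lintegral_smul_measure, smul_eq_mul]
  by_cases h0 : P (M.success β) = 0
  · simp [h0, Measure.restrict_eq_zero.2 h0]
  · rw [mul_right_comm, ENNReal.inv_mul_cancel h0 (measure_ne_top _ _), one_mul]

lemma successProb_eq_toReal_setLIntegral :
    M.successProb P β = (∫⁻ _ω in M.success β, 1 ∂P).toReal := by
  rw [setLIntegral_one, successProb, measureReal_def]

/-- The expectation of a gated function of the SINR when the unknown interference is Gamma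
distributed with shape `ρ + n` and rate `θmax`, up to normalization, at signal gain `x`. -/
noncomputable def shapeIntegral (h : ℝ → ℝ≥0∞) (n : ℕ) (x : ℝ) : ℝ≥0∞ :=
  ∫⁻ y, gammaKernel M.thetaMax (M.rho + n) y * M.gated h x y

/-- The average of `shapeIntegral` over the signal gain if that is unknown; gains up to the
threshold contribute nothing. -/
noncomputable def shapeMean (h : ℝ → ℝ≥0∞) (n : ℕ) : ℝ≥0∞ :=
  if M.j ∈ M.unknown then
    ∫⁻ x in Set.Ioi M.threshold, ENNReal.ofReal (M.f x) * M.shapeIntegral h n x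
  else M.shapeIntegral h n (M.knownGain M.j)

lemma measurable_shapeIntegral {h : ℝ → ℝ≥0∞} (hh : Measurable h) (n : ℕ) :
    Measurable (M.shapeIntegral h n) :=
  Measurable.lintegral_prod_right'
    (f := fun p : ℝ × ℝ => gammaKernel M.thetaMax (M.rho + n) p.2 * M.gated h p.1 p.2)
    (((measurable_gammaKernel _ _).comp measurable_snd).mul (M.measurable_gated hh))

lemma le_sinrAt_iff {x y : ℝ} (hy : 0 ≤ y) : M.xiMin ≤ M.sinrAt x y ↔ y ≤ M.margin x := by
  have := M.nu_pos
  rw [sinrAt, margin, le_div_iff₀ (by positivity), le_sub_iff_add_le, le_div_iff₀ M.xiMin_pos,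
    mul_comm, add_comm]

lemma margin_pos_iff {x : ℝ} : 0 < M.margin x ↔ M.threshold < x := by
  rw [margin, threshold, sub_pos, lt_div_iff₀ M.xiMin_pos, div_lt_iff₀ M.lam_j_pos, mul_comm,
    mul_comm x]

lemma shapeIntegral_eq (hne : M.interferers.Nonempty) (h : ℝ → ℝ≥0∞) (n : ℕ) (x : ℝ) :
    M.shapeIntegral h n x = ENNReal.ofReal (Real.Gamma (M.rho + n))⁻¹ *
      ∫⁻ y in Set.Ioc 0 (M.margin x),
        ENNReal.ofReal (y ^ (M.rho + n - 1) * Real.exp (-(y * M.thetaMax))) *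
          h (M.sinrAt x y) := by
  have hρ := M.rho_pos hne
  have hG := Real.Gamma_pos_of_pos (show 0 < M.rho + n by positivity)
  rw [← lintegral_const_mul' _ _ ENNReal.ofReal_ne_top, ← lintegral_indicator measurableSet_Ioc]
  refine lintegral_congr fun y => ?_
  rcases le_or_gt y 0 with hy | hy
  · rw [gammaKernel_of_nonpos hy, Set.indicator_of_notMem fun h => hy.not_gt h.1, zero_mul]
  by_cases hm : y ≤ M.margin x
  · rw [Set.indicator_of_mem (show y ∈ Set.Ioc 0 (M.margin x) from ⟨hy, hm⟩), gated,
      if_pos ((M.le_sinrAt_iff hy.le).2 hm), gammaKernel_of_pos hy, ← mul_assoc,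
      ← ENNReal.ofReal_mul (by positivity), div_eq_inv_mul]
  · rw [Set.indicator_of_notMem fun h => hm h.2, gated,
      if_neg fun h => hm ((M.le_sinrAt_iff hy.le).1 h), mul_zero]

lemma shapeIntegral_eq_zero (hne : M.interferers.Nonempty) (h : ℝ → ℝ≥0∞) (n : ℕ) {x : ℝ}
    (hx : x ≤ M.threshold) : M.shapeIntegral h n x = 0 := by
  rw [M.shapeIntegral_eq hne, Set.Ioc_eq_empty fun h => hx.not_gt (M.margin_pos_iff.1 h)]
  simp

lemma lintegral_interferenceDensity_mul_gated (hne : M.interferers.Nonempty) {h : ℝ → ℝ≥0∞}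
    (hh : Measurable h) (x : ℝ) :
    ∫⁻ y, M.interferenceDensity y * M.gated h x y = ENNReal.ofReal M.rateProd *
      ∑' n : ℕ, ENNReal.ofReal (M.delta n * M.thetaMax ^ n) * M.shapeIntegral h n x := by
  have hg : Measurable (M.gated h x) := (M.measurable_gated hh).comp measurable_prodMk_left
  simp_rw [interferenceDensity, gammaMixture, M.coeff_prod_negBinomialSeries hne, mul_assoc,
    ← ENNReal.tsum_mul_right]
  rw [lintegral_const_mul _ (by fun_prop), lintegral_tsum fun n => by fun_prop]
  congr 1
  refine tsum_congr fun n => ?_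
  rw [shapeIntegral, ← lintegral_const_mul _ (by fun_prop)]
  exact lintegral_congr fun y => by ring

lemma Fading.setLIntegral_success_of_signal_known {M : LinkModel ι} [IsProbabilityMeasure P]
    (hβ : M.Fading P β) (hne : M.interferers.Nonempty) (hj : M.j ∉ M.unknown)
    {h : ℝ → ℝ≥0∞} (hh : Measurable h) :
    ∫⁻ ω in M.success β, h (M.sinr β ω) ∂P =
      ∫⁻ y, M.interferenceDensity y * M.gated h (M.knownGain M.j) y := by
  have hg : Measurable (M.gated h (M.knownGain M.j)) :=
    (M.measurable_gated hh).comp measurable_prodMk_left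
  rw [hβ.setLIntegral_success]
  simp only [gain, hj, if_false]
  rw [(hβ.hasLaw_interference hne).lintegral_comp hg.aemeasurable,
    lintegral_withDensity_eq_lintegral_mul _ (by fun_prop) hg]
  rfl

lemma Fading.setLIntegral_success_of_signal_unknown {M : LinkModel ι} [IsProbabilityMeasure P]
    (hβ : M.Fading P β) (hne : M.interferers.Nonempty) (hj : M.j ∈ M.unknown)
    {h : ℝ → ℝ≥0∞} (hh : Measurable h) :
    ∫⁻ ω in M.success β, h (M.sinr β ω) ∂P =
      ∫⁻ x, ENNReal.ofReal (M.f x) * ∫⁻ y, M.interferenceDensity y * M.gated h x y := by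
  have hg := M.measurable_gated hh
  have hlaw := hβ.hasLaw_interference hne
  have hsig := hβ.signal hj
  have hp1 := hlaw.isProbabilityMeasure_iff.1 inferInstance
  have hp2 := hsig.isProbabilityMeasure_iff.1 inferInstance
  have hpair := (hβ.indepFun_signal_interference hj).hasLaw_prod hsig hlaw
  have hf := M.f_measurable
  have hinner : Measurable fun x => ∫⁻ y, M.gated h x y ∂volume.withDensity M.interferenceDensity :=
    hg.lintegral_prod_right'
  rw [hβ.setLIntegral_success]
  simp only [gain, hj, if_true]
  rw [hpair.lintegral_comp (f := fun p => M.gated h p.1 p.2) hg.aemeasurable,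
    lintegral_prod _ hg.aemeasurable,
    lintegral_withDensity_eq_lintegral_mul _ (by fun_prop) hinner]
  refine lintegral_congr fun x => ?_
  have hgx : Measurable (M.gated h x) := hg.comp measurable_prodMk_left
  rw [Pi.mul_apply, lintegral_withDensity_eq_lintegral_mul _ (by fun_prop) hgx]
  rfl

/-- Every expectation over the event of success is a series over the Gamma components of the
interference. -/
lemma Fading.setLIntegral_success_eq_tsum {M : LinkModel ι} [IsProbabilityMeasure P]
    (hβ : M.Fading P β) (hne : M.interferers.Nonempty) {h : ℝ → ℝ≥0∞} (hh : Measurable h) :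
    ∫⁻ ω in M.success β, h (M.sinr β ω) ∂P = ENNReal.ofReal M.rateProd *
      ∑' n : ℕ, ENNReal.ofReal (M.delta n * M.thetaMax ^ n) * M.shapeMean h n := by
  by_cases hj : M.j ∈ M.unknown
  · have hf := M.f_measurable
    have hs := M.measurable_shapeIntegral hh
    simp only [shapeMean, hj, if_true]
    rw [hβ.setLIntegral_success_of_signal_unknown hne hj hh]
    simp_rw [M.lintegral_interferenceDensity_mul_gated hne hh]
    rw [← setLIntegral_eq_of_support_subset (s := Set.Ioi M.threshold)]
    · simp_rw [mul_left_comm _ (ENNReal.ofReal M.rateProd)]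
      rw [lintegral_const_mul' _ _ ENNReal.ofReal_ne_top]
      congr 1
      simp_rw [← ENNReal.tsum_mul_left]
      rw [lintegral_tsum fun n => by fun_prop]
      refine tsum_congr fun n => ?_
      rw [← lintegral_const_mul _ (by fun_prop)]
      exact lintegral_congr fun x => by ring
    · refine Function.support_subset_iff'.2 fun x hx => ?_
      simp [M.shapeIntegral_eq_zero hne h _ (not_lt.1 hx)]
  · simp only [shapeMean, hj, if_false]
    rw [hβ.setLIntegral_success_of_signal_known hne hj hh,
      M.lintegral_interferenceDensity_mul_gated hne hh]

end Random

end LinkModel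

/-! ### Contribution of each Gamma component -/

lemma intervalIntegrable_rpow_mul_exp {s : ℝ} (hs : 0 < s) (θ a : ℝ) :
    IntervalIntegrable (fun y => y ^ (s - 1) * Real.exp (-(y * θ))) volume 0 a :=
  (intervalIntegral.intervalIntegrable_rpow' (by linarith)).mul_continuousOn (by fun_prop)

lemma setLIntegral_rpow_mul_exp {s θ a : ℝ} (hs : 0 < s) (hθ : 0 < θ) (ha : 0 ≤ a) :
    ∫⁻ y in Set.Ioc 0 a, ENNReal.ofReal (y ^ (s - 1) * Real.exp (-(y * θ))) =
      ENNReal.ofReal (θ ^ (-s) * lowerGamma s (a * θ)) := by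
  have hsub := intervalIntegral.integral_comp_mul_right (a := 0) (b := a)
    (fun t => t ^ (s - 1) * Real.exp (-t)) hθ.ne'
  rw [zero_mul, smul_eq_mul] at hsub
  have hcongr : ∫ y in (0 : ℝ)..a, (y * θ) ^ (s - 1) * Real.exp (-(y * θ)) =
      θ ^ (s - 1) * ∫ y in (0 : ℝ)..a, y ^ (s - 1) * Real.exp (-(y * θ)) := by
    rw [← intervalIntegral.integral_const_mul]
    refine intervalIntegral.integral_congr fun y hy => ?_
    rw [Set.uIcc_of_le ha] at hy
    simp only [Real.mul_rpow hy.1 hθ.le]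
    ring
  have hθs : θ ^ (-s) = θ⁻¹ * (θ ^ (s - 1))⁻¹ := by
    rw [← Real.rpow_neg hθ.le, ← Real.rpow_neg_one θ, ← Real.rpow_add hθ]
    congr 1
    ring
  have hpos : 0 < θ ^ (s - 1) := by positivity
  have hint := (intervalIntegrable_iff_integrableOn_Ioc_of_le ha).1
    (intervalIntegrable_rpow_mul_exp hs θ a)
  rw [← ofReal_integral_eq_lintegral_ofReal hint, ← intervalIntegral.integral_of_le ha]
  · rw [lowerGamma, hθs, mul_right_comm, ← hsub, hcongr, mul_comm (θ ^ (s - 1)),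
      mul_inv_cancel_right₀ hpos.ne']
  · filter_upwards [ae_restrict_mem measurableSet_Ioc] with y hy
    have := hy.1
    positivity

lemma lowerGamma_nonneg (s : ℝ) {x : ℝ} (hx : 0 ≤ x) : 0 ≤ lowerGamma s x :=
  intervalIntegral.integral_nonneg hx fun t ht => by have := ht.1; positivity

lemma ofReal_logb_eq {b s : ℝ} (hb : 1 < b) :
    ENNReal.ofReal (Real.logb b (1 + s)) =
      ENNReal.ofReal (Real.logb b (Real.exp 1)) * ENNReal.ofReal (Real.log (1 + s)) := by
  have := Real.log_pos hb
  rw [← ENNReal.ofReal_mul (by rw [Real.logb, Real.log_exp]; positivity), Real.logb, Real.logb,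
    Real.log_exp]
  congr 1
  ring

lemma measurable_ofReal_logb (b : ℝ) :
    Measurable fun s : ℝ => ENNReal.ofReal (Real.logb b (1 + s)) := by
  unfold Real.logb
  fun_prop

namespace LinkModel

variable {ι : Type*} [DecidableEq ι] (M : LinkModel ι)

lemma shapeIntegral_one (hne : M.interferers.Nonempty) (n : ℕ) (x : ℝ) :
    M.shapeIntegral (fun _ => 1) n x = ENNReal.ofReal ((Real.Gamma (M.rho + n))⁻¹ *
      M.thetaMax ^ (-(M.rho + n)) * lowerGamma (M.rho + n) (max 0 (M.margin x) * M.thetaMax)) := by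
  have hρ := M.rho_pos hne
  have hG := Real.Gamma_pos_of_pos (show 0 < M.rho + n by positivity)
  have hIoc : Set.Ioc 0 (M.margin x) = Set.Ioc 0 (max 0 (M.margin x)) := by
    rcases le_total (M.margin x) 0 with h | h
    · rw [max_eq_left h, Set.Ioc_self, Set.Ioc_eq_empty h.not_gt]
    · rw [max_eq_right h]
  rw [M.shapeIntegral_eq hne, hIoc]
  simp only [mul_one]
  rw [setLIntegral_rpow_mul_exp (by positivity) (M.thetaMax_pos hne) (le_max_left _ _),
    ← ENNReal.ofReal_mul (by positivity), mul_assoc]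

/-- In this form no integrability is needed: both the Bochner integral in `coeffC` and `toReal`
vanish on a divergent integral. -/
lemma toReal_shapeMean_one (hne : M.interferers.Nonempty) (n : ℕ) :
    (M.shapeMean (fun _ => 1) n).toReal =
      (Real.Gamma (M.rho + n))⁻¹ * M.thetaMax ^ (-(M.rho + n)) * M.coeffC n := by
  have hρ := M.rho_pos hne
  have hθ := M.thetaMax_pos hne
  have hG := Real.Gamma_pos_of_pos (show 0 < M.rho + n by positivity)
  have hval (x : ℝ) : (M.shapeIntegral (fun _ => 1) n x).toReal = (Real.Gamma (M.rho + n))⁻¹ *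
      M.thetaMax ^ (-(M.rho + n)) * lowerGamma (M.rho + n) (max 0 (M.margin x) * M.thetaMax) := by
    rw [M.shapeIntegral_one hne, ENNReal.toReal_ofReal]
    have := lowerGamma_nonneg (M.rho + n)
      (show 0 ≤ max 0 (M.margin x) * M.thetaMax by positivity)
    positivity
  rw [shapeMean, coeffC]
  split_ifs with hj
  · have hf := M.f_measurable
    have hs := M.measurable_shapeIntegral (h := fun _ => 1) measurable_const n
    rw [← integral_toReal (by fun_prop) (ae_of_all _ fun x => ENNReal.mul_lt_top
      ENNReal.ofReal_lt_top (by rw [M.shapeIntegral_one hne]; exact ENNReal.ofReal_lt_top)),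
      ← integral_const_mul]
    refine setIntegral_congr_fun measurableSet_Ioi fun x hx => ?_
    simp only [ENNReal.toReal_mul, hval, ENNReal.toReal_ofReal (M.f_nonneg x),
      max_eq_right (M.margin_pos_iff.2 hx).le]
    ring
  · rw [hval, eta]

lemma shapeIntegral_logb (hne : M.interferers.Nonempty) {b : ℝ} (hb : 1 < b) (n : ℕ) (x : ℝ) :
    M.shapeIntegral (fun s => ENNReal.ofReal (Real.logb b (1 + s))) n x =
      ENNReal.ofReal (Real.logb b (Real.exp 1)) * (ENNReal.ofReal (Real.Gamma (M.rho + n))⁻¹ *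
        ∫⁻ y in Set.Ioc 0 (M.margin x), ENNReal.ofReal (M.muKernel n x y)) := by
  rw [M.shapeIntegral_eq hne, mul_left_comm]
  congr 1
  rw [← lintegral_const_mul' _ _ ENNReal.ofReal_ne_top]
  refine setLIntegral_congr_fun measurableSet_Ioc fun y hy => ?_
  have := hy.1
  simp only [ofReal_logb_eq hb, muKernel, sinrAt]
  rw [mul_left_comm, ← ENNReal.ofReal_mul (by positivity)]
  congr 2
  ring

lemma shapeMean_logb (hne : M.interferers.Nonempty) {b : ℝ} (hb : 1 < b) (n : ℕ) :
    M.shapeMean (fun s => ENNReal.ofReal (Real.logb b (1 + s))) n =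
      ENNReal.ofReal (Real.logb b (Real.exp 1)) *
        (ENNReal.ofReal (Real.Gamma (M.rho + n))⁻¹ * M.mu n) := by
  rw [shapeMean, mu]
  split_ifs with hj
  · rw [← lintegral_const_mul' _ _ ENNReal.ofReal_ne_top,
      ← lintegral_const_mul' _ _ ENNReal.ofReal_ne_top]
    refine lintegral_congr fun x => ?_
    rw [M.shapeIntegral_logb hne hb, mul_left_comm, mul_left_comm (ENNReal.ofReal (M.f x)),
      ← lintegral_const_mul' _ _ ENNReal.ofReal_ne_top]
    congr 2
    refine lintegral_congr fun y => ?_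
    rw [← ENNReal.ofReal_mul (M.f_nonneg x), mul_comm]
  · rw [M.shapeIntegral_logb hne hb]
    rcases le_total (M.margin (M.knownGain M.j)) 0 with h | h
    · rw [eta, max_eq_left h, Set.Ioc_self, Set.Ioc_eq_empty h.not_gt]
    · rw [eta, max_eq_right h]

section Random

variable {Ω : Type*} [MeasurableSpace Ω] {P : Measure Ω} {β : ι → Ω → ℝ}

/-! ### Success probability and rate with unknown interference -/

lemma Fading.hasSum_successProb {M : LinkModel ι} [IsProbabilityMeasure P] (hβ : M.Fading P β)
    (hne : M.interferers.Nonempty) :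
    HasSum (fun n : ℕ => M.rateProd *
      (M.delta n * M.thetaMax ^ (-M.rho) * M.coeffC n / Real.Gamma (M.rho + n)))
      (M.successProb P β) := by
  have hθ := M.thetaMax_pos hne
  have htotal := hβ.setLIntegral_success_eq_tsum hne (h := fun _ => 1) measurable_const
  rw [← ENNReal.tsum_mul_left] at htotal
  have hfin : ∫⁻ _ω in M.success β, 1 ∂P ≠ ∞ := by
    rw [setLIntegral_one]
    exact measure_ne_top _ _
  have hsum := ENNReal.hasSum_toReal (htotal ▸ hfin)
  rw [← ENNReal.tsum_toReal_eq (ENNReal.ne_top_of_tsum_ne_top (htotal ▸ hfin)), ← htotal,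
    ← M.successProb_eq_toReal_setLIntegral] at hsum
  convert hsum using 2 with n
  rw [ENNReal.toReal_mul, ENNReal.toReal_mul, M.toReal_shapeMean_one hne,
    ENNReal.toReal_ofReal M.rateProd_pos.le,
    ENNReal.toReal_ofReal (mul_nonneg (M.delta_nonneg n) (by positivity)),
    show M.thetaMax ^ (-M.rho) = M.thetaMax ^ n * M.thetaMax ^ (-(M.rho + n)) by
      rw [← Real.rpow_natCast, ← Real.rpow_add hθ]; congr 1; ring]
  ring

lemma Fading.expectedRate_eq_tsum {M : LinkModel ι} [IsProbabilityMeasure P] (hβ : M.Fading P β)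
    (hne : M.interferers.Nonempty) {b : ℝ} (hb : 1 < b) :
    M.expectedRate b P β = ENNReal.ofReal (Real.logb b (Real.exp 1) * M.rateProd) *
      ∑' n : ℕ, ENNReal.ofReal (M.delta n * M.thetaMax ^ n / Real.Gamma (M.rho + n)) * M.mu n := by
  have hθ := M.thetaMax_pos hne
  rw [M.expectedRate_eq_setLIntegral,
    hβ.setLIntegral_success_eq_tsum hne (measurable_ofReal_logb b),
    mul_comm (Real.logb b _), ENNReal.ofReal_mul M.rateProd_pos.le, mul_assoc,
    ← ENNReal.tsum_mul_left (a := ENNReal.ofReal (Real.logb b (Real.exp 1)))]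
  congr 1
  refine tsum_congr fun n => ?_
  rw [M.shapeMean_logb hne hb, div_eq_mul_inv,
    ENNReal.ofReal_mul (mul_nonneg (M.delta_nonneg n) (by positivity))]
  ring

/-- The rate is finite because for a known signal gain the SINR is at most its value without unknown
interference. -/
lemma Fading.expectedRate_ne_top {M : LinkModel ι} [IsProbabilityMeasure P] (hβ : M.Fading P β)
    (hne : M.interferers.Nonempty) (hj : M.j ∉ M.unknown) {b : ℝ} (hb : 1 < b) :
    M.expectedRate b P β ≠ ∞ := by
  have hν := M.nu_pos
  have hx : 0 ≤ M.lam M.j * M.knownGain M.j :=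
    mul_nonneg M.lam_j_pos.le (M.knownGain_nonneg _ (Finset.mem_sdiff.2 ⟨M.j_mem, hj⟩))
  have hp := (hβ.hasLaw_interference hne).isProbabilityMeasure_iff.1 inferInstance
  have hone : ∫⁻ y, M.interferenceDensity y = 1 := by
    rw [← setLIntegral_univ, ← withDensity_apply _ MeasurableSet.univ, measure_univ]
  rw [M.expectedRate_eq_setLIntegral,
    hβ.setLIntegral_success_of_signal_known hne hj (measurable_ofReal_logb b)]
  set B : ℝ≥0∞ := ENNReal.ofReal (Real.logb b (1 + M.sinrAt (M.knownGain M.j) 0))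
  have hle : ∫⁻ y, M.interferenceDensity y * M.gated
      (fun s => ENNReal.ofReal (Real.logb b (1 + s))) (M.knownGain M.j) y ≤
      ∫⁻ y, M.interferenceDensity y * B := by
    refine lintegral_mono fun y => ?_
    rcases le_or_gt y 0 with hy | hy
    · simp [interferenceDensity, gammaMixture_of_nonpos _ hy]
    · refine mul_le_mul_right ?_ _
      rw [gated]
      split_ifs
      · refine ENNReal.ofReal_le_ofReal (Real.logb_le_logb_of_le hb ?_ ?_)
        · rw [sinrAt]; positivity
        · rw [sinrAt, sinrAt, add_zero]
          gcongr
          linarith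
      · exact zero_le
  refine ne_top_of_le_ne_top ?_ hle
  rw [lintegral_mul_const' _ _ ENNReal.ofReal_ne_top, hone, one_mul]
  exact ENNReal.ofReal_ne_top

/-! ### Success probability and rate without unknown interference -/

lemma Fading.setLIntegral_success_of_no_interferers_signal_known {M : LinkModel ι}
    [IsProbabilityMeasure P] (hβ : M.Fading P β) (hne : M.interferers = ∅) (hj : M.j ∉ M.unknown)
    (h : ℝ → ℝ≥0∞) :
    ∫⁻ ω in M.success β, h (M.sinr β ω) ∂P = M.gated h (M.knownGain M.j) 0 := by
  rw [hβ.setLIntegral_success]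
  simp [gain, hj, M.interference_eq_zero hne]

lemma Fading.setLIntegral_success_of_no_interferers_signal_unknown {M : LinkModel ι}
    (hβ : M.Fading P β) (hne : M.interferers = ∅) (hj : M.j ∈ M.unknown)
    {h : ℝ → ℝ≥0∞} (hh : Measurable h) :
    ∫⁻ ω in M.success β, h (M.sinr β ω) ∂P =
      ∫⁻ x in Set.Ioi M.threshold, ENNReal.ofReal (M.f x) * h (M.lam M.j * x / M.nu) := by
  have hf := M.f_measurable
  have hg : Measurable fun x => M.gated h x 0 :=
    (M.measurable_gated hh).comp measurable_prodMk_right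
  rw [hβ.setLIntegral_success]
  simp only [gain, hj, if_true, M.interference_eq_zero hne]
  rw [(hβ.signal hj).lintegral_comp (f := fun x => M.gated h x 0) hg.aemeasurable,
    lintegral_withDensity_eq_lintegral_mul _ (by fun_prop) hg,
    -- The threshold itself is a gain with success, but the density does not charge it.
    ← setLIntegral_congr (Ioi_ae_eq_Ici (a := M.threshold)).symm,
    ← lintegral_indicator measurableSet_Ici]
  refine lintegral_congr fun x => ?_
  have hiff : M.xiMin ≤ M.sinrAt x 0 ↔ M.threshold ≤ x := by
    rw [sinrAt, add_zero, threshold, le_div_iff₀ M.nu_pos, div_le_iff₀' M.lam_j_pos]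
  by_cases hx : M.threshold ≤ x
  · rw [Set.indicator_of_mem (show x ∈ Set.Ici M.threshold from hx), Pi.mul_apply, gated,
      if_pos (hiff.2 hx), sinrAt, add_zero]
  · rw [Set.indicator_of_notMem (show x ∉ Set.Ici M.threshold from hx), Pi.mul_apply, gated,
      if_neg fun h => hx (hiff.1 h), mul_zero]

end Random

end LinkModel

theorem proposition1 {ι : Type*} [DecidableEq ι] (M : LinkModel ι)
    {Ω : Type*} [MeasurableSpace Ω] (P : Measure Ω) [IsProbabilityMeasure P]
    (β : ι → Ω → ℝ) (hβ : M.Fading P β) (b : ℝ) (hb : 1 < b) :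
    -- at least one interferer with unknown gain
    (M.interferers.Nonempty →
      HasSum
        (fun n : ℕ => M.rateProd *
          (M.delta n * M.thetaMax ^ (-M.rho) * M.coeffC n / Real.Gamma (M.rho + n)))
        (M.successProb P β) ∧
      (∀ n : ℕ, 0 ≤ M.delta n) ∧
      M.expectedRate b P β =
        ENNReal.ofReal (Real.logb b (Real.exp 1) * M.rateProd) *
          ∑' n : ℕ, ENNReal.ofReal (M.delta n * M.thetaMax ^ n / Real.Gamma (M.rho + n)) *
            M.mu n ∧
      (M.j ∉ M.unknown → M.expectedRate b P β ≠ ∞)) ∧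
    -- no interferer with unknown gain, known signal gain
    (M.interferers = ∅ → M.j ∉ M.unknown →
      M.successProb P β =
        (if M.xiMin ≤ M.lam M.j * M.knownGain M.j / M.nu then 1 else 0) ∧
      M.expectedRate b P β =
        ENNReal.ofReal (Real.logb b (1 + M.lam M.j * M.knownGain M.j / M.nu) *
          (if M.xiMin ≤ M.lam M.j * M.knownGain M.j / M.nu then 1 else 0))) ∧
    -- no interferer with unknown gain, unknown signal gain
    (M.interferers = ∅ → M.j ∈ M.unknown →
      M.successProb P β = ∫ x in Set.Ioi M.threshold, M.f x ∧
      M.expectedRate b P β =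
        ∫⁻ x in Set.Ioi M.threshold,
          ENNReal.ofReal (Real.logb b (1 + M.lam M.j * x / M.nu) * M.f x)) := by
  refine ⟨fun hne => ⟨hβ.hasSum_successProb hne, M.delta_nonneg, hβ.expectedRate_eq_tsum hne hb,
    fun hj => hβ.expectedRate_ne_top hne hj hb⟩, fun hne hj => ⟨?_, ?_⟩, fun hne hj => ⟨?_, ?_⟩⟩
  · rw [M.successProb_eq_toReal_setLIntegral,
      hβ.setLIntegral_success_of_no_interferers_signal_known hne hj fun _ => 1,
      LinkModel.gated, LinkModel.sinrAt, add_zero]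
    split_ifs <;> rfl
  · rw [M.expectedRate_eq_setLIntegral,
      hβ.setLIntegral_success_of_no_interferers_signal_known hne hj
        fun s => ENNReal.ofReal (Real.logb b (1 + s)), LinkModel.gated, LinkModel.sinrAt, add_zero]
    split_ifs <;> simp
  · rw [M.successProb_eq_toReal_setLIntegral,
      hβ.setLIntegral_success_of_no_interferers_signal_unknown hne hj (h := fun _ => 1)
        measurable_const,
      integral_eq_lintegral_of_nonneg_ae (ae_of_all _ M.f_nonneg)
        M.f_measurable.aestronglyMeasurable]
    simp only [mul_one]
  · rw [M.expectedRate_eq_setLIntegral,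
      hβ.setLIntegral_success_of_no_interferers_signal_unknown hne hj (measurable_ofReal_logb b)]
    refine lintegral_congr fun x => ?_
    rw [← ENNReal.ofReal_mul (M.f_nonneg x), mul_comm]
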